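/- **Setting.** Work in the presheaf model of multi-clocked guarded recursion (the set-level part of the standard model of Clocked Cubical Type Theory). A *time object* is a pair $(E,\theta)$ of a finite set $E$ of clocks and a function $\theta:E\to\mathbb N$ (the ticks left on each clock); a morphism $(E,\theta)\to(E',\theta')$ is a map $\sigma:E\to E'$ with $\theta'(\sigma(i))\le\theta(i)$ for all $i$. A *context* $\Gamma$ is a covariant presheaf on time objects, a *type* in context $\Gamma$ is a covariant presheaf on the category of elements $\int\Gamma$, and a *clock* in context $\Gamma$ is a natural family $\kappa:\Gamma(E,\theta)\to E$. Products and function types $Y^S$ are those of the presheaf category. For a clock $\kappa$, the later modality is $$(\triangleright^\kappa A)(E,\theta,\gamma)=\begin{cases}1&\text{if }\theta(\kappa(\gamma))=0,\\ A(E,\theta[\kappa(\gamma)\mapsto n],\gamma|)&\text{if }\theta(\kappa(\gamma))=n+1,\end{cases}$$ where $\gamma|$ is the restriction of $\gamma$ along $\mathrm{id}_E:(E,\theta)\to(E,\theta[\kappa(\gamma)\mapsto n])$. The guarded delay monad $D^\kappa$ sends $A$ to the guarded recursive type $D^\kappa A\simeq A+\triangleright^\kappa(D^\kappa A)$, with inclusions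 $\mathsf{now}^\kappa:A\to D^\kappa A$ and $\mathsf{step}^\kappa:\triangleright^\kappa D^\kappa A\to D^\kappa A$, unit $\mathsf{now}^\kappa$, and bind given by $(\mathsf{now}^\kappa x\mathbin{>\!\!>\!\!=}\varphi)=\varphi(x)$ and $(\mathsf{step}^\kappa d\mathbin{>\!\!>\!\!=}\varphi)=\mathsf{step}^\kappa(\lambda\alpha.\,(d[\alpha]\mathbin{>\!\!>\!\!=}\varphi))$. A type $A$ is *clock irrelevant* if the canonical map $A\to\forall\kappa'.A$ ($\kappa'$ a fresh clock) is an isomorphism, where $(\forall\kappa'.A)(E,\theta,\gamma)=\lim_n A(E\sqcup\{\ast\},\theta[\ast\mapsto n],\gamma|)$; a *set* in context $\Gamma$ is a clock irrelevant type, and $\mathbf{Set}_\Gamma$ is the category of sets and maps between them. **GSD-algebras.** Let $S$ be a set in context $\Gamma$. A *GSD-algebra* is a set $Y$ with maps $\mathsf{lookup}:Y^S\to Y$, $\mathsf{update}:Y\to Y^S$, $\mathsf{step}:\triangleright^\kappa Y\to Y$ satisfying (as equations in the internal language) $$\mathsf{lookup}(\lambda s.\,\mathsf{lookup}(f\,s))=\mathsf{lookup}(\lambda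 s.\,f\,s\,s)\quad(f:(Y^S)^S),\qquad \mathsf{lookup}(\mathsf{update}\,x)=x\quad(x:Y),$$ $$\mathsf{update}(\mathsf{lookup}\,g)\,s=\mathsf{update}(g\,s)\,s\quad(g:Y^S,\ s:S),\qquad \mathsf{update}(\mathsf{update}\,x\,s)\,t=\mathsf{update}\,x\,s\quad(x:Y,\ s,t:S),$$ $$\mathsf{step}(\lambda\alpha.\,\mathsf{lookup}(d[\alpha]))=\mathsf{lookup}(\lambda s.\,\mathsf{step}(\lambda\alpha.\,d[\alpha]\,s))\quad(d:\triangleright^\kappa(Y^S)),$$ $$\lambda s.\,\mathsf{update}(\mathsf{step}\,x)\,s=\lambda s.\,\mathsf{step}(\lambda\alpha.\,\mathsf{update}(x[\alpha])\,s)\quad(x:\triangleright^\kappa Y).$$ Homomorphisms are maps commuting with the three operations; $U:\mathrm{GSD\text{-}alg}\to\mathbf{Set}_\Gamma$ is the forgetful functor. **Theorem 4.2.** For every context $\Gamma$, every clock $\kappa$ in $\Gamma$ and every set $S$ in $\Gamma$, the monad $(D^\kappa(S\times-))^S$ on $\mathbf{Set}_\Gamma$, with unit $x\mapsto\lambda s.\,\mathsf{now}^\kappa(s,x)$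 and multiplication $m\mapsto\lambda s.\,\bigl(m\,s\mathbin{>\!\!>\!\!=}\lambda(s',k).\,k\,s'\bigr)$, is the free model monad of the theory of GSD-algebras: $U$ has a left adjoint, and the monad on $\mathbf{Set}_\Gamma$ induced by this adjunction is isomorphic, as a monad, to $(D^\kappa(S\times-))^S$. -/

import Mathlib

open CategoryTheory MonoidalCategory CartesianMonoidalCategory

universe u

namespace GuardedState

/-! ### Time objects, contexts, types

Types are presheaves over the category of time objects: this is the set-level (hset) part of the
standard presheaf model of multi-clocked guarded recursion. -/

/-- A time object: finitely many clocks, each with the number of ticks it has left. -/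
structure TimeObj where
  card : ℕ
  time : Fin card → ℕ

namespace TimeObj

/-- A morphism renames clocks (possibly identifying some, possibly adding new ones) and may let
time pass on them. -/
@[ext]
structure Hom (c d : TimeObj) where
  toFun : Fin c.card → Fin d.card
  le : ∀ i, d.time (toFun i) ≤ c.time i

instance : Category TimeObj where
  Hom := Hom
  id c := ⟨fun i => i, fun _ => le_rfl⟩
  comp f g := ⟨fun i => g.toFun (f.toFun i), fun i => (g.le _).trans (f.le i)⟩

/-- The renaming of clocks underlying a morphism. -/
def onClocks {c d : TimeObj} (f : c ⟶ d) : Fin c.card → Fin d.card := Hom.toFun f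

lemma time_le {c d : TimeObj} (f : c ⟶ d) (i : Fin c.card) : d.time (onClocks f i) ≤ c.time i :=
  Hom.le f i

/-- One tick of the clock `i` (with truncated subtraction; it is only used when `i` has time
left). -/
def tick (c : TimeObj) (i : Fin c.card) : TimeObj :=
  ⟨c.card, Function.update c.time i (c.time i - 1)⟩

/-- Letting the clock `i` tick. -/
def toTick (c : TimeObj) (i : Fin c.card) : c ⟶ c.tick i where
  toFun j := j
  le j := by
    simp only [tick, Function.update_apply]
    split_ifs with h
    · subst h; omega
    · exact le_rfl

lemma update_le {c d : TimeObj} (f : c ⟶ d) (i k : Fin c.card) :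
    Function.update d.time (onClocks f i) (d.time (onClocks f i) - 1) (onClocks f k) ≤
      Function.update c.time i (c.time i - 1) k := by
  have h1 := time_le f k
  have h2 := time_le f i
  by_cases hk : k = i
  · rw [hk, Function.update_self, Function.update_self]
    omega
  · rw [Function.update_of_ne hk]
    by_cases hk' : onClocks f k = onClocks f i
    · rw [hk'] at h1 ⊢
      rw [Function.update_self]
      omega
    · rw [Function.update_of_ne hk']
      exact h1

def tickMap {c d : TimeObj} (f : c ⟶ d) {i : Fin c.card} {j : Fin d.card}
    (hij : j = onClocks f i) : c.tick i ⟶ d.tick j where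
  toFun := (onClocks f :)
  le k := by
    subst hij
    exact update_le f i k

/-- Adding one new clock, number `0`, that has `n` ticks left. -/
def fresh (c : TimeObj) (n : ℕ) : TimeObj := ⟨c.card + 1, Fin.cons n c.time⟩

def toFresh (c : TimeObj) (n : ℕ) : c ⟶ c.fresh n where
  toFun := Fin.succ
  le i := le_of_eq (by simp [fresh])

/-- Letting time pass on the new clock only. -/
def freshLE (c : TimeObj) {m n : ℕ} (h : m ≤ n) : c.fresh n ⟶ c.fresh m where
  toFun i := i
  le i := by
    refine Fin.cases ?_ (fun i => ?_) i
    · simpa [fresh] using h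
    · simp [fresh]

def freshMap {c d : TimeObj} (f : c ⟶ d) (n : ℕ) : c.fresh n ⟶ d.fresh n where
  toFun := Fin.cons (0 : Fin (d.card + 1)) (fun i => (onClocks f i).succ)
  le i := by
    refine Fin.cases ?_ (fun i => ?_) i
    · simp [fresh]
    · simpa [fresh] using time_le f i

/-- Identifying the new clock with a clock `i` that has at most as much time left. -/
def collapse (c : TimeObj) {n : ℕ} (i : Fin c.card) (h : c.time i ≤ n) : c.fresh n ⟶ c where
  toFun := Fin.cons i (fun j => j)
  le j := by
    refine Fin.cases ?_ (fun j => ?_) j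
    · simpa [fresh] using h
    · simp [fresh]

lemma freshMap_comp {c d e : TimeObj} (f : c ⟶ d) (g : d ⟶ e) (n : ℕ) :
    freshMap (f ≫ g) n = freshMap f n ≫ freshMap g n := by
  apply Hom.ext
  funext i
  refine Fin.cases (n := c.card) ?_ (fun i => ?_) i <;> rfl

lemma freshMap_collapse {c d : TimeObj} {n : ℕ} (f : c.fresh n ⟶ d)
    (h : d.time (onClocks f (0 : Fin (c.card + 1))) ≤ n) :
    freshMap (c.toFresh n ≫ f) n ≫ d.collapse (onClocks f (0 : Fin (c.card + 1))) h = f := by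
  apply Hom.ext
  funext i
  refine Fin.cases (n := c.card) ?_ (fun i => ?_) i <;> rfl

lemma fresh_tick_time (c : TimeObj) (n : ℕ) (i : Fin c.card) :
    ((c.fresh n).tick i.succ).time = ((c.tick i).fresh n).time := by
  change Function.update (Fin.cons n c.time : Fin (c.card + 1) → ℕ) i.succ
    ((Fin.cons n c.time : Fin (c.card + 1) → ℕ) i.succ - 1) =
      (Fin.cons n (Function.update c.time i (c.time i - 1)) : Fin (c.card + 1) → ℕ)
  rw [Fin.cons_succ, ← Fin.cons_update]

def freshTick (c : TimeObj) (n : ℕ) (i : Fin c.card) {j : Fin (c.fresh n).card}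
    (hj : j = i.succ) : (c.fresh n).tick j ⟶ (c.tick i).fresh n where
  toFun k := k
  le k := by
    subst hj
    exact le_of_eq (congrFun (c.fresh_tick_time n i).symm k)

def tickFresh (c : TimeObj) (n : ℕ) (i : Fin c.card) {j : Fin (c.fresh n).card}
    (hj : j = i.succ) : (c.tick i).fresh n ⟶ (c.fresh n).tick j where
  toFun k := k
  le k := by
    subst hj
    exact le_of_eq (congrFun (c.fresh_tick_time n i) k)

end TimeObj

/-- Contexts. -/
abbrev Ctx := TimeObj ⥤ Type u

/-- Types in the context `Γ`. Terms and maps are natural transformations, products are Mathlib's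
products of functors, and the function type `Y ^ S` is Mathlib's internal hom
`(ihom S).obj Y`. -/
abbrev Ty (Γ : Ctx.{u}) := Γ.Elements ⥤ Type u

/-- A clock in the context `Γ`, i.e. a natural transformation from `Γ` to the presheaf
`c ↦ Fin c.card` of clocks. -/
structure Clock (Γ : Ctx.{u}) where
  app : ∀ c : TimeObj, Γ.obj c → Fin c.card
  naturality : ∀ {c d : TimeObj} (f : c ⟶ d) (γ : Γ.obj c),
    app d (Γ.map f γ) = TimeObj.onClocks f (app c γ)

/-! ### Clock irrelevance -/

section Forall

variable {Γ : Ctx.{u}}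

/-- Adding a new clock to a stage of `Γ`. -/
def fresh (c : Γ.Elements) (n : ℕ) : Γ.Elements :=
  ⟨c.1.fresh n, Γ.map (c.1.toFresh n) c.2⟩

def toFresh (c : Γ.Elements) (n : ℕ) : c ⟶ fresh c n := ⟨c.1.toFresh n, rfl⟩

def freshLE (c : Γ.Elements) {m n : ℕ} (h : m ≤ n) : fresh c n ⟶ fresh c m :=
  ⟨c.1.freshLE h, by
    have : c.1.toFresh n ≫ c.1.freshLE h = c.1.toFresh m := rfl
    simp only [fresh, ← this, Functor.map_comp]; rfl⟩

lemma toFresh_freshLE (c : Γ.Elements) {m n : ℕ} (h : m ≤ n) :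
    toFresh c n ≫ freshLE c h = toFresh c m := rfl

def freshMap {c d : Γ.Elements} (f : c ⟶ d) (n : ℕ) : fresh c n ⟶ fresh d n :=
  ⟨TimeObj.freshMap f.1 n, by
    have h : c.1.toFresh n ≫ TimeObj.freshMap f.1 n = f.1 ≫ d.1.toFresh n := rfl
    have h' := ConcreteCategory.congr_hom (congrArg Γ.map h) c.2
    rw [Γ.map_comp, Γ.map_comp, comp_apply, comp_apply, f.2] at h'
    exact h'⟩

def collapse (c : Γ.Elements) {n : ℕ} (i : Fin c.1.card) (h : c.1.time i ≤ n) : fresh c n ⟶ c :=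
  ⟨c.1.collapse i h, by
    have h : c.1.toFresh n ≫ c.1.collapse i h = 𝟙 _ := rfl
    have h' := ConcreteCategory.congr_hom (congrArg Γ.map h) c.2
    rw [Γ.map_comp, Γ.map_id, comp_apply] at h'
    exact h'⟩

lemma toFresh_freshMap {c d : Γ.Elements} (f : c ⟶ d) (n : ℕ) :
    toFresh c n ≫ freshMap f n = f ≫ toFresh d n := rfl

lemma freshMap_freshLE {c d : Γ.Elements} (f : c ⟶ d) {m n : ℕ} (h : m ≤ n) :
    freshMap f n ≫ freshLE d h = freshLE c h ≫ freshMap f m := rfl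

lemma toFresh_collapse (c : Γ.Elements) {n : ℕ} (i : Fin c.1.card) (h : c.1.time i ≤ n) :
    toFresh c n ≫ collapse c i h = 𝟙 c := rfl

lemma freshMap_comp {c d e : Γ.Elements} (f : c ⟶ d) (g : d ⟶ e) (n : ℕ) :
    freshMap (f ≫ g) n = freshMap f n ≫ freshMap g n :=
  CategoryOfElements.ext _ _ _ (TimeObj.freshMap_comp f.1 g.1 n)

lemma freshMap_collapse {c d : Γ.Elements} {n : ℕ} (f : fresh c n ⟶ d)
    (h : d.1.time (TimeObj.onClocks f.1 (0 : Fin (c.1.card + 1))) ≤ n) :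
    freshMap (toFresh c n ≫ f) n ≫
      collapse d (TimeObj.onClocks f.1 (0 : Fin (c.1.card + 1))) h = f :=
  CategoryOfElements.ext _ _ _ (TimeObj.freshMap_collapse f.1 h)

/-- The elements of `∀ κ', A` at the stage `c`, where `κ'` is a fresh clock variable, which does
not occur in `A`: compatible families of elements of `A`, indexed by the time left on the new
clock. -/
def ForallClock (A : Ty Γ) (c : Γ.Elements) : Type u :=
  {a : ∀ n : ℕ, A.obj (fresh c n) // ∀ (m n : ℕ) (h : m ≤ n), A.map (freshLE c h) (a n) = a m}

/-- The canonical map `A → ∀ κ', A`. -/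
def toForallClock (A : Ty Γ) (c : Γ.Elements) (x : A.obj c) : ForallClock A c :=
  ⟨fun n => A.map (toFresh c n) x, fun m n h => by
    simp only [← toFresh_freshLE c h, Functor.map_comp, comp_apply]⟩

/-- `A` is clock irrelevant if the canonical map `A → ∀ κ', A` is an equivalence. -/
def ClockIrrelevant : ObjectProperty (Ty Γ) :=
  fun A => ∀ c, Function.Bijective (toForallClock A c)

lemma ClockIrrelevant.ext {A : Ty Γ} (hA : ClockIrrelevant A) {c : Γ.Elements} {x y : A.obj c}
    (h : ∀ n, A.map (toFresh c n) x = A.map (toFresh c n) y) : x = y :=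
  (hA c).1 (Subtype.ext (funext h))

lemma ClockIrrelevant.exists_eq {A : Ty Γ} (hA : ClockIrrelevant A) {c : Γ.Elements}
    (a : ∀ n : ℕ, A.obj (fresh c n))
    (ha : ∀ (m n : ℕ) (h : m ≤ n), A.map (freshLE c h) (a n) = a m) :
    ∃ x, ∀ n, A.map (toFresh c n) x = a n := by
  obtain ⟨x, hx⟩ := (hA c).2 ⟨a, ha⟩
  exact ⟨x, fun n => congrFun (congrArg Subtype.val hx) n⟩

lemma clockIrrelevant_of {A : Ty Γ}
    (h1 : ∀ (c : Γ.Elements) (x y : A.obj c),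
      (∀ n, A.map (toFresh c n) x = A.map (toFresh c n) y) → x = y)
    (h2 : ∀ (c : Γ.Elements) (a : ∀ n : ℕ, A.obj (fresh c n)),
      (∀ (m n : ℕ) (h : m ≤ n), A.map (freshLE c h) (a n) = a m) →
      ∃ x, ∀ n, A.map (toFresh c n) x = a n) : ClockIrrelevant A := by
  intro c
  constructor
  · intro x y h
    exact h1 c x y fun n => congrFun (congrArg Subtype.val h) n
  · rintro ⟨a, ha⟩
    obtain ⟨x, hx⟩ := h2 c a ha
    exact ⟨x, Subtype.ext (funext hx)⟩

lemma ClockIrrelevant.prod {A B : Ty Γ} (hA : ClockIrrelevant A) (hB : ClockIrrelevant B) :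
    ClockIrrelevant (A ⊗ B) := by
  apply clockIrrelevant_of
  · intro c x y h
    exact Prod.ext (hA.ext fun n => congrArg Prod.fst (h n))
      (hB.ext fun n => congrArg Prod.snd (h n))
  · intro c a ha
    obtain ⟨x, hx⟩ := hA.exists_eq (fun n => (a n).1) fun m n h => congrArg Prod.fst (ha m n h)
    obtain ⟨y, hy⟩ := hB.exists_eq (fun n => (a n).2) fun m n h => congrArg Prod.snd (ha m n h)
    exact ⟨(x, y), fun n => Prod.ext (hx n) (hy n)⟩

/-- The value at `s` of an element of `A ^ S` at the stage `c`, after restriction along `f`. -/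
def expApp {S A : Ty Γ} {c d : Γ.Elements} (φ : (S.functorHom A).obj c) (f : c ⟶ d)
    (s : S.obj d) : A.obj d := Functor.HomObj.app φ d f s

lemma map_expApp {S A : Ty Γ} {c d e : Γ.Elements} (φ : (S.functorHom A).obj c) (f : c ⟶ d)
    (g : d ⟶ e) (s : S.obj d) : A.map g (expApp φ f s) = expApp φ (f ≫ g) (S.map g s) :=
  (ConcreteCategory.congr_hom (Functor.HomObj.naturality φ g f) s).symm

lemma expApp_map {S A : Ty Γ} {c d e : Γ.Elements} (φ : (S.functorHom A).obj c) (f : c ⟶ d)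
    (g : d ⟶ e) (s : S.obj e) : expApp ((S.functorHom A).map f φ) g s = expApp φ (f ≫ g) s := rfl

lemma exp_ext {S A : Ty Γ} {c : Γ.Elements} {φ ψ : (S.functorHom A).obj c}
    (h : ∀ (d : Γ.Elements) (f : c ⟶ d) (s : S.obj d), expApp φ f s = expApp ψ f s) : φ = ψ := by
  apply Functor.functorHom_ext
  intro d f
  ext s
  exact h d f s

lemma ClockIrrelevant.exp (S : Ty Γ) {A : Ty Γ} (hA : ClockIrrelevant A) :
    ClockIrrelevant ((ihom S).obj A) := by
  change ClockIrrelevant (S.functorHom A)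
  apply clockIrrelevant_of
  · intro c φ ψ h
    apply exp_ext
    intro d f s
    apply hA.ext
    intro n
    rw [map_expApp, map_expApp, ← toFresh_freshMap, ← expApp_map, ← expApp_map, h]
  · intro c φ hφ
    have key : ∀ (d : Γ.Elements) (f : c ⟶ d) (s : S.obj d), ∃ x : A.obj d, ∀ n,
        A.map (toFresh d n) x = expApp (φ n) (freshMap f n) (S.map (toFresh d n) s) := by
      intro d f s
      apply hA.exists_eq
      intro m n h
      rw [map_expApp, ← hφ m n h, expApp_map, freshMap_freshLE, ← comp_apply, ← S.map_comp,
        toFresh_freshLE]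
    choose x hx using key
    refine ⟨{ app d f := ↾(x d f), naturality := ?_ }, ?_⟩
    · intro d e g f
      ext s
      apply hA.ext
      intro n
      change A.map (toFresh e n) (x e (f ≫ g) (S.map g s)) =
        A.map (toFresh e n) (A.map g (x d f s))
      rw [hx, ← comp_apply, ← comp_apply, ← A.map_comp, ← S.map_comp, ← toFresh_freshMap,
        A.map_comp, S.map_comp, comp_apply, comp_apply, hx, map_expApp,
        ← freshMap_comp]
    · intro n
      apply exp_ext
      intro d f s
      change x d (toFresh c n ≫ f) s = _
      have hn : d.1.time (TimeObj.onClocks f.1 (0 : Fin (c.1.card + 1))) ≤ n :=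
        TimeObj.time_le f.1 (0 : Fin (c.1.card + 1))
      have h := congrArg (A.map (collapse d _ hn)) (hx d (toFresh c n ≫ f) s n)
      rw [map_expApp, freshMap_collapse f hn, ← comp_apply, ← comp_apply, ← A.map_comp,
        ← S.map_comp, toFresh_collapse, A.map_id, S.map_id] at h
      exact h

end Forall

/-- The category of sets in the context `Γ`: a set is a clock irrelevant type. -/
abbrev SetTy (Γ : Ctx.{u}) := (ClockIrrelevant (Γ := Γ)).FullSubcategory

/-! ### The later modality -/

section Later

variable {Γ : Ctx.{u}} (κ : Clock Γ)

/-- The number of ticks that the clock `κ` has left at a stage. -/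
def Clock.left (c : Γ.Elements) : ℕ := c.1.time (κ.app c.1 c.2)

/-- The stage reached by one tick of the clock `κ`. -/
def Clock.tick (c : Γ.Elements) : Γ.Elements :=
  ⟨c.1.tick (κ.app c.1 c.2), Γ.map (c.1.toTick _) c.2⟩

def Clock.toTick (c : Γ.Elements) : c ⟶ κ.tick c := ⟨c.1.toTick _, rfl⟩

lemma Clock.app_eq {c d : Γ.Elements} (f : c ⟶ d) :
    κ.app d.1 d.2 = TimeObj.onClocks f.1 (κ.app c.1 c.2) := by
  rw [← κ.naturality, f.2]

lemma Clock.left_le {c d : Γ.Elements} (f : c ⟶ d) : κ.left d ≤ κ.left c := by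
  unfold Clock.left
  rw [κ.app_eq f]
  exact TimeObj.time_le f.1 _

def Clock.tickMap {c d : Γ.Elements} (f : c ⟶ d) : κ.tick c ⟶ κ.tick d :=
  ⟨TimeObj.tickMap f.1 (κ.app_eq f), by
    have h : c.1.toTick _ ≫ TimeObj.tickMap f.1 (κ.app_eq f) = f.1 ≫ d.1.toTick _ := rfl
    have h' := ConcreteCategory.congr_hom (congrArg Γ.map h) c.2
    rw [Γ.map_comp, Γ.map_comp, comp_apply, comp_apply] at h'
    rw [f.2] at h'
    exact h'⟩

lemma Clock.tickMap_id (c : Γ.Elements) : κ.tickMap (𝟙 c) = 𝟙 _ := rfl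

lemma Clock.tickMap_comp {c d e : Γ.Elements} (f : c ⟶ d) (g : d ⟶ e) :
    κ.tickMap (f ≫ g) = κ.tickMap f ≫ κ.tickMap g := rfl

lemma Clock.toTick_tickMap {c d : Γ.Elements} (f : c ⟶ d) :
    κ.toTick c ≫ κ.tickMap f = f ≫ κ.toTick d := rfl

/-- The later modality `▷` on the clock `κ`. An element of `▷ A` is an element of `A` one tick
later; it is trivial when `κ` has no tick left. -/
def later : Ty Γ ⥤ Ty Γ where
  obj A :=
    { obj c := 0 < κ.left c → A.obj (κ.tick c)
      map f := ↾fun a h => A.map (κ.tickMap f) (a (h.trans_le (κ.left_le f)))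
      map_id c := by ext a h; simp [Clock.tickMap_id]
      map_comp f g := by ext a h; simp [Clock.tickMap_comp] }
  map φ :=
    { app c := ↾fun a h => φ.app _ (a h)
      naturality c d f := by ext a h; simp [NatTrans.naturality_apply] }
  map_id A := by ext c a; rfl
  map_comp φ ψ := by ext c a; rfl

/-- `S × ▷ A → ▷ (S × A)`, `(s, d) ↦ λ α. (s, d [α])`. -/
def laterStrength (S A : Ty Γ) : S ⊗ (later κ).obj A ⟶ (later κ).obj (S ⊗ A) where
  app c := ↾fun x h => (S.map (κ.toTick c) x.1, x.2 h)
  naturality c d f := by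
    ext x
    funext h
    refine Prod.ext ?_ rfl
    change S.map (κ.toTick d) (S.map f x.1) = S.map (κ.tickMap f) (S.map (κ.toTick c) x.1)
    rw [← comp_apply, ← comp_apply, ← S.map_comp, ← S.map_comp, Clock.toTick_tickMap]

/-- `▷ (A ^ S) → (▷ A) ^ S`, `d ↦ λ s. λ α. d [α] s`. -/
noncomputable def laterExp (S A : Ty Γ) :
    (later κ).obj ((ihom S).obj A) ⟶ (ihom S).obj ((later κ).obj A) :=
  MonoidalClosed.curry (laterStrength κ S _ ≫ (later κ).map ((ihom.ev S).app A))

end Later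

/-! ### The guarded delay monad -/

section Delay

variable {Γ : Ctx.{u}} (κ : Clock Γ)

/-- The elements of the guarded recursive type `D A ≃ A + ▷ (D A)`. -/
inductive Delay (A : Ty Γ) : Γ.Elements → Type u
  | now {c : Γ.Elements} (x : A.obj c) : Delay A c
  | step {c : Γ.Elements} (d : 0 < κ.left c → Delay A (κ.tick c)) : Delay A c

variable {κ}

def Delay.restrict {A : Ty Γ} : ∀ {c d : Γ.Elements} (_ : c ⟶ d), Delay κ A c → Delay κ A d
  | _, _, f, .now x => .now (A.map f x)
  | _, _, f, .step a => .step fun h =>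
      Delay.restrict (κ.tickMap f) (a (h.trans_le (κ.left_le f)))

lemma Delay.restrict_id {A : Ty Γ} {c : Γ.Elements} (x : Delay κ A c) : x.restrict (𝟙 c) = x := by
  induction x with
  | now x => simp [Delay.restrict]
  | step d ih => simp only [Delay.restrict, Clock.tickMap_id, ih]

lemma Delay.restrict_comp {A : Ty Γ} {c d e : Γ.Elements} (f : c ⟶ d) (g : d ⟶ e)
    (x : Delay κ A c) : x.restrict (f ≫ g) = (x.restrict f).restrict g := by
  induction x generalizing d e with
  | now x => simp [Delay.restrict]
  | step d ih => simp only [Delay.restrict, Clock.tickMap_comp, ih]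

variable (κ)

/-- The type `D A`. -/
def delayTy (A : Ty Γ) : Ty Γ where
  obj c := Delay κ A c
  map f := ↾Delay.restrict f
  map_id c := by ext x; exact x.restrict_id
  map_comp f g := by ext x; exact x.restrict_comp f g

/-- `now : A → D A` -/
def now (A : Ty Γ) : A ⟶ delayTy κ A where
  app _ := ↾Delay.now
  naturality _ _ _ := rfl

/-- `step : ▷ (D A) → D A` -/
def step (A : Ty Γ) : (later κ).obj (delayTy κ A) ⟶ delayTy κ A where
  app _ := ↾Delay.step
  naturality _ _ _ := rfl

/-- `now` and `step` exhibit `D A` as a solution of `D A ≃ A + ▷ (D A)`. -/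
lemma bijective_now_step (A : Ty Γ) (c : Γ.Elements) :
    Function.Bijective
      (Sum.elim ((now κ A).app c) ((step κ A).app c) :
        A.obj c ⊕ ((later κ).obj (delayTy κ A)).obj c → (delayTy κ A).obj c) := by
  constructor
  · rintro (x | x) (y | y) h
    · exact congrArg Sum.inl (Delay.now.inj h)
    · cases h
    · cases h
    · exact congrArg Sum.inr (Delay.step.inj h)
  · rintro (x | d)
    · exact ⟨Sum.inl x, rfl⟩
    · exact ⟨Sum.inr d, rfl⟩

variable {κ}

/-- The extension of `φ : A → D B` to `D A → D B`:
`now x ↦ φ x` and `step d ↦ step (λ α. φ' (d [α]))`, where `φ'` is the extension. -/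
def Delay.bind {A B : Ty Γ} (φ : A ⟶ delayTy κ B) : ∀ {c : Γ.Elements}, Delay κ A c → Delay κ B c
  | _, .now x => φ.app _ x
  | _, .step d => .step fun h => Delay.bind φ (d h)

lemma Delay.bind_restrict {A B : Ty Γ} (φ : A ⟶ delayTy κ B) {c d : Γ.Elements} (f : c ⟶ d)
    (x : Delay κ A c) : (x.restrict f).bind φ = (x.bind φ).restrict f := by
  induction x generalizing d with
  | now x => exact NatTrans.naturality_apply φ f x
  | step d ih => simp only [Delay.restrict, Delay.bind, ih]

def delayExt {A B : Ty Γ} (φ : A ⟶ delayTy κ B) : delayTy κ A ⟶ delayTy κ B where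
  app c := ↾Delay.bind φ
  naturality c d f := by ext x; exact x.bind_restrict φ f

lemma now_delayExt {A B : Ty Γ} (φ : A ⟶ delayTy κ B) : now κ A ≫ delayExt φ = φ := rfl

lemma delayExt_now (A : Ty Γ) : delayExt (now κ A) = 𝟙 _ := by
  ext c x
  change x.bind _ = x
  induction x with
  | now x => rfl
  | step d ih => simp only [Delay.bind, ih]

lemma delayExt_comp {A B C : Ty Γ} (φ : A ⟶ delayTy κ B) (ψ : B ⟶ delayTy κ C) :
    delayExt φ ≫ delayExt ψ = delayExt (φ ≫ delayExt ψ) := by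
  ext c x
  change (x.bind _).bind _ = x.bind _
  induction x with
  | now x => rfl
  | step d ih => simp only [Delay.bind, ih]

variable (κ)

/-- The guarded delay monad. -/
def delayMonad : CategoryTheory.Monad (Ty Γ) where
  obj A := delayTy κ A
  map φ := delayExt (φ ≫ now κ _)
  map_id A := by rw [Category.id_comp, delayExt_now]
  map_comp φ ψ := by
    rw [delayExt_comp, Category.assoc, Category.assoc, now_delayExt]
  η := { app := fun A => now κ A }
  μ :=
    { app := fun A => delayExt (𝟙 (delayTy κ A))
      naturality := fun A B φ => by
        dsimp
        simp only [delayExt_comp, Category.assoc, now_delayExt, Category.comp_id,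
          Category.id_comp] }
  assoc A := by
    dsimp
    simp only [delayExt_comp, Category.assoc, now_delayExt, Category.comp_id, Category.id_comp]
  left_unit A := now_delayExt _
  right_unit A := by
    dsimp
    rw [delayExt_comp, Category.assoc, now_delayExt, Category.comp_id, delayExt_now]

lemma delayExt_ev {S A B : Ty Γ} (f : A ⟶ delayTy κ B) :
    delayExt (S ◁ (ihom S).map (delayExt f) ≫ (ihom.ev S).app (delayTy κ B)) =
      delayExt ((ihom.ev S).app (delayTy κ A)) ≫ delayExt f := by
  rw [ihom.ev_naturality, delayExt_comp]

/-- The monad `X ↦ (D (S × X)) ^ S` obtained from the guarded delay monad by the state monad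
transformer. Its unit is `x ↦ λ s. now (s, x)`, and its multiplication sends `m` to
`λ s. (m s >>= λ (s', k). k s')`, where `>>=` is that of the guarded delay monad. -/
noncomputable def stateDelay (S : Ty Γ) : CategoryTheory.Monad (Ty Γ) where
  obj X := (ihom S).obj (delayTy κ (S ⊗ X))
  map φ := (ihom S).map (delayExt ((S ◁ φ) ≫ now κ _))
  map_id X := by
    rw [MonoidalCategory.whiskerLeft_id, Category.id_comp, delayExt_now]
    exact (ihom S).map_id _
  map_comp φ ψ := by
    rw [← Functor.map_comp, delayExt_comp, Category.assoc, now_delayExt,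
      MonoidalCategory.whiskerLeft_comp, Category.assoc]
  η :=
    { app X := MonoidalClosed.curry (now κ (S ⊗ X))
      naturality X Y φ := by
        dsimp only [Functor.id_obj, Functor.id_map]
        rw [← MonoidalClosed.curry_natural_left, ← MonoidalClosed.curry_natural_right,
          now_delayExt] }
  μ :=
    { app X := (ihom S).map (delayExt ((ihom.ev S).app (delayTy κ (S ⊗ X))))
      naturality X Y φ := by
        dsimp only [Functor.comp_obj, Functor.comp_map]
        rw [← Functor.map_comp, ← Functor.map_comp, delayExt_comp, Category.assoc, now_delayExt,
          delayExt_ev] }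
  assoc X := by
    dsimp only
    rw [← Functor.map_comp, ← Functor.map_comp, delayExt_comp, Category.assoc, now_delayExt,
      delayExt_ev]
  left_unit X := by
    change MonoidalClosed.curry (now κ (S ⊗ (ihom S).obj (delayTy κ (S ⊗ X)))) ≫
      (ihom S).map (delayExt ((ihom.ev S).app (delayTy κ (S ⊗ X)))) = 𝟙 _
    rw [← MonoidalClosed.curry_natural_right]
    refine (congrArg MonoidalClosed.curry (now_delayExt _)).trans ?_
    rw [← MonoidalClosed.uncurry_id_eq_ev, MonoidalClosed.curry_uncurry]
  right_unit X := by
    dsimp only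
    rw [← Functor.map_comp, delayExt_comp, Category.assoc, now_delayExt,
      ← MonoidalClosed.uncurry_eq, MonoidalClosed.uncurry_curry]
    exact (congrArg (ihom S).map (delayExt_now (S ⊗ X))).trans ((ihom S).map_id _)

lemma Delay.restrict_now {A : Ty Γ} {c d : Γ.Elements} (f : c ⟶ d) (x : A.obj c) :
    Delay.restrict (κ := κ) f (Delay.now x) = Delay.now (A.map f x) := rfl

lemma Delay.restrict_step {A : Ty Γ} {c d : Γ.Elements} (f : c ⟶ d)
    (a : 0 < κ.left c → Delay κ A (κ.tick c)) :
    Delay.restrict f (Delay.step a) = Delay.step fun h =>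
      Delay.restrict (κ.tickMap f) (a (h.trans_le (κ.left_le f))) := rfl

lemma Clock.left_fresh (c : Γ.Elements) (n : ℕ) : κ.left (fresh c n) = κ.left c := by
  unfold Clock.left
  rw [κ.app_eq (toFresh c n)]
  rfl

lemma Clock.left_tick {c : Γ.Elements} (h : 0 < κ.left c) : κ.left (κ.tick c) < κ.left c := by
  unfold Clock.left at h ⊢
  rw [κ.app_eq (κ.toTick c)]
  change Function.update c.1.time (κ.app c.1 c.2) (c.1.time (κ.app c.1 c.2) - 1)
    (κ.app c.1 c.2) < _
  rw [Function.update_self]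
  omega

lemma Clock.app_fresh (c : Γ.Elements) (n : ℕ) :
    κ.app (fresh c n).1 (fresh c n).2 = Fin.succ (κ.app c.1 c.2) :=
  κ.app_eq (toFresh c n)

/-- Ticking commutes with adding a fresh clock. -/
def Clock.freshTick (c : Γ.Elements) (n : ℕ) : κ.tick (fresh c n) ⟶ fresh (κ.tick c) n :=
  ⟨TimeObj.freshTick c.1 n _ (κ.app_fresh c n), by
    have h : c.1.toFresh n ≫ (c.1.fresh n).toTick _ ≫ TimeObj.freshTick c.1 n _
      (κ.app_fresh c n) = c.1.toTick _ ≫ (c.1.tick _).toFresh n := rfl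
    have h' := ConcreteCategory.congr_hom (congrArg Γ.map h) c.2
    rw [Γ.map_comp, Γ.map_comp, Γ.map_comp, comp_apply, comp_apply, comp_apply] at h'
    exact h'⟩

def Clock.tickFresh (c : Γ.Elements) (n : ℕ) : fresh (κ.tick c) n ⟶ κ.tick (fresh c n) :=
  ⟨TimeObj.tickFresh c.1 n _ (κ.app_fresh c n), by
    have h : c.1.toTick _ ≫ (c.1.tick _).toFresh n ≫ TimeObj.tickFresh c.1 n _
      (κ.app_fresh c n) = c.1.toFresh n ≫ (c.1.fresh n).toTick _ := rfl
    have h' := ConcreteCategory.congr_hom (congrArg Γ.map h) c.2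
    rw [Γ.map_comp, Γ.map_comp, Γ.map_comp, comp_apply, comp_apply, comp_apply] at h'
    exact h'⟩

lemma Clock.freshTick_tickFresh (c : Γ.Elements) (n : ℕ) :
    κ.freshTick c n ≫ κ.tickFresh c n = 𝟙 _ := rfl

lemma Clock.tickMap_toFresh_freshTick (c : Γ.Elements) (n : ℕ) :
    κ.tickMap (toFresh c n) ≫ κ.freshTick c n = toFresh (κ.tick c) n := rfl

lemma Clock.tickMap_freshLE_freshTick (c : Γ.Elements) {m n : ℕ} (h : m ≤ n) :
    κ.tickMap (freshLE c h) ≫ κ.freshTick c m = κ.freshTick c n ≫ freshLE (κ.tick c) h := rfl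

lemma Delay.restrict_fresh_inj {A : Ty Γ} (hA : ClockIrrelevant A) {c : Γ.Elements}
    (x y : Delay κ A c) (h : ∀ n, x.restrict (toFresh c n) = y.restrict (toFresh c n)) :
    x = y := by
  induction x with
  | now x =>
    cases y with
    | now y => exact congrArg Delay.now (hA.ext fun n => Delay.now.inj (h n))
    | step e => cases h 0
  | @step c d ih =>
    cases y with
    | now y => cases h 0
    | step e =>
      refine congrArg Delay.step (funext fun hc => ih hc _ fun n => ?_)
      have hn := congrFun (Delay.step.inj (h n)) (hc.trans_eq (κ.left_fresh c n).symm)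
      have := congrArg (Delay.restrict (κ.freshTick c n)) hn
      rwa [← Delay.restrict_comp, ← Delay.restrict_comp,
        κ.tickMap_toFresh_freshTick] at this

lemma Delay.exists_restrict_fresh {A : Ty Γ} (hA : ClockIrrelevant A) (c : Γ.Elements)
    (a : ∀ n : ℕ, Delay κ A (fresh c n))
    (ha : ∀ (m n : ℕ) (h : m ≤ n), (a n).restrict (freshLE c h) = a m) :
    ∃ x : Delay κ A c, ∀ n, x.restrict (toFresh c n) = a n := by
  induction hr : κ.left c using Nat.strong_induction_on generalizing c with
  | _ r ih =>
  subst hr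
  cases h0 : a 0 with
  | now x0 =>
    have hnow : ∀ n, ∃ x : A.obj (fresh c n), a n = Delay.now x := by
      intro n
      have hn := ha 0 n (Nat.zero_le n)
      cases h : a n with
      | now x => exact ⟨x, rfl⟩
      | step d => rw [h, h0] at hn; cases hn
    choose x hx using hnow
    obtain ⟨y, hy⟩ := hA.exists_eq x fun m n h => by
      have := ha m n h
      rw [hx, hx] at this
      exact Delay.now.inj this
    exact ⟨Delay.now y, fun n => by rw [hx, Delay.restrict_now, hy]⟩
  | step d0 =>
    have hstep : ∀ n, ∃ d, a n = Delay.step d := by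
      intro n
      have hn := ha 0 n (Nat.zero_le n)
      cases h : a n with
      | now x => rw [h, h0] at hn; cases hn
      | step d => exact ⟨d, rfl⟩
    choose d hd using hstep
    have key : ∀ hc : 0 < κ.left c, ∃ x : Delay κ A (κ.tick c), ∀ n,
        x.restrict (toFresh (κ.tick c) n) =
          (d n (hc.trans_eq (κ.left_fresh c n).symm)).restrict (κ.freshTick c n) := by
      intro hc
      refine ih _ (κ.left_tick hc) (κ.tick c) _ (fun m n h => ?_) rfl
      have hmn := ha m n h
      rw [hd, hd, Delay.restrict_step] at hmn
      have := congrFun (Delay.step.inj hmn) (hc.trans_eq (κ.left_fresh c m).symm)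
      rw [← this, ← Delay.restrict_comp, ← Delay.restrict_comp,
        κ.tickMap_freshLE_freshTick]
    choose x hx using key
    refine ⟨Delay.step x, fun n => ?_⟩
    rw [hd, Delay.restrict_step]
    refine congrArg Delay.step (funext fun hc => ?_)
    have h := congrArg (Delay.restrict (κ.tickFresh c n))
      (hx (hc.trans_eq (κ.left_fresh c n)) n)
    rw [← κ.tickMap_toFresh_freshTick, ← Delay.restrict_comp, ← Delay.restrict_comp,
      Category.assoc, κ.freshTick_tickFresh, Category.comp_id, Delay.restrict_id] at h
    exact h

lemma ClockIrrelevant.delay {A : Ty Γ} (hA : ClockIrrelevant A) :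
    ClockIrrelevant (delayTy κ A) :=
  clockIrrelevant_of (fun _ x y h => Delay.restrict_fresh_inj κ hA x y h)
    (fun c a ha => Delay.exists_restrict_fresh κ hA c a ha)

lemma ClockIrrelevant.stateDelay {S X : Ty Γ} (hS : ClockIrrelevant S) (hX : ClockIrrelevant X) :
    ClockIrrelevant ((stateDelay κ S).obj X) :=
  ((hS.prod hX).delay κ).exp S

/-- The monad `X ↦ (D (S × X)) ^ S` on the category of sets, for a set `S`. -/
noncomputable def stateDelayMonad (S : SetTy Γ) : CategoryTheory.Monad (SetTy Γ) where
  obj X := ⟨(stateDelay κ S.obj).obj X.obj, S.property.stateDelay κ X.property⟩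
  map φ := ObjectProperty.homMk ((stateDelay κ S.obj).map φ.hom)
  map_id X := ObjectProperty.hom_ext _ ((stateDelay κ S.obj).map_id X.obj)
  map_comp φ ψ := ObjectProperty.hom_ext _ ((stateDelay κ S.obj).map_comp φ.hom ψ.hom)
  η :=
    { app X := ObjectProperty.homMk ((stateDelay κ S.obj).η.app X.obj)
      naturality _ _ φ := ObjectProperty.hom_ext _ ((stateDelay κ S.obj).η.naturality φ.hom) }
  μ :=
    { app X := ObjectProperty.homMk ((stateDelay κ S.obj).μ.app X.obj)
      naturality _ _ φ := ObjectProperty.hom_ext _ ((stateDelay κ S.obj).μ.naturality φ.hom) }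
  assoc X := ObjectProperty.hom_ext _ ((stateDelay κ S.obj).assoc X.obj)
  left_unit X := ObjectProperty.hom_ext _ ((stateDelay κ S.obj).left_unit X.obj)
  right_unit X := ObjectProperty.hom_ext _ ((stateDelay κ S.obj).right_unit X.obj)

end Delay

/-! ### GSD-algebras -/

section Algebras

variable {Γ : Ctx.{u}}

/-- `(Y ^ S) ^ S → Y ^ S`, `f ↦ λ s. f s s`. -/
noncomputable def expDiag (S Y : Ty Γ) : (ihom S).obj ((ihom S).obj Y) ⟶ (ihom S).obj Y :=
  MonoidalClosed.curry
    (lift (fst S ((ihom S).obj ((ihom S).obj Y))) ((ihom.ev S).app ((ihom S).obj Y)) ≫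
      (ihom.ev S).app Y)

/-- `Y → Y ^ S`, `y ↦ λ s. y`. -/
noncomputable def expConst (S Y : Ty Γ) : Y ⟶ (ihom S).obj Y :=
  MonoidalClosed.curry (snd S Y)

/-- A GSD-algebra: a set with operations `lookup` and `update` that satisfy the equations of
global state, and with a delay algebra structure that commutes with both. -/
structure GSDAlg (κ : Clock Γ) (S : SetTy Γ) where
  carrier : SetTy Γ
  lookup : (ihom S.obj).obj carrier.obj ⟶ carrier.obj
  update : carrier.obj ⟶ (ihom S.obj).obj carrier.obj
  step : (later κ).obj carrier.obj ⟶ carrier.obj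
  /-- `lookup (λ s. lookup (f s)) = lookup (λ s. f s s)` -/
  lookup_lookup : (ihom S.obj).map lookup ≫ lookup = expDiag S.obj carrier.obj ≫ lookup
  /-- `lookup (update x) = x` -/
  lookup_update : update ≫ lookup = 𝟙 carrier.obj
  /-- `λ s. update (lookup g) s = λ s. update (g s) s` -/
  update_lookup : lookup ≫ update = (ihom S.obj).map update ≫ expDiag S.obj carrier.obj
  /-- `λ s. λ t. update (update x s) t = λ s. λ t. update x s` -/
  update_update : update ≫ (ihom S.obj).map update =
    update ≫ (ihom S.obj).map (expConst S.obj carrier.obj)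
  /-- `step (λ α. lookup (d [α])) = lookup (λ s. step (λ α. d [α] s))` -/
  step_lookup : (later κ).map lookup ≫ step =
    laterExp κ S.obj carrier.obj ≫ (ihom S.obj).map step ≫ lookup
  /-- `λ s. update (step x) s = λ s. step (λ α. update (x [α]) s)` -/
  update_step : step ≫ update =
    (later κ).map update ≫ laterExp κ S.obj carrier.obj ≫ (ihom S.obj).map step

/-- A homomorphism of GSD-algebras: a map of sets that commutes with the three operations. -/
@[ext]
structure GSDAlg.Hom {κ : Clock Γ} {S : SetTy Γ} (A B : GSDAlg κ S) where
  map : A.carrier ⟶ B.carrier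
  map_lookup : A.lookup ≫ map.hom = (ihom S.obj).map map.hom ≫ B.lookup
  map_update : A.update ≫ (ihom S.obj).map map.hom = map.hom ≫ B.update
  map_step : A.step ≫ map.hom = (later κ).map map.hom ≫ B.step

instance (κ : Clock Γ) (S : SetTy Γ) : Category (GSDAlg κ S) where
  Hom := GSDAlg.Hom
  id A :=
    { map := 𝟙 _
      map_lookup := by simp
      map_update := by simp
      map_step := by simp }
  comp f g :=
    { map := f.map ≫ g.map
      map_lookup := by
        simp [reassoc_of% f.map_lookup, g.map_lookup]
      map_update := by
        simp [reassoc_of% f.map_update, g.map_update]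
      map_step := by
        simp [reassoc_of% f.map_step, g.map_step] }

/-- The forgetful functor from GSD-algebras to sets. -/
def GSDAlg.forget (κ : Clock Γ) (S : SetTy Γ) : GSDAlg κ S ⥤ SetTy Γ where
  obj A := A.carrier
  map f := GSDAlg.Hom.map f

end Algebras

end GuardedState

/-!
Write `M X = (D (S × X)) ^ S`. The power `A ^ S` of any type `A` with a map `▷ A → A` carries the
operations of a GSD-algebra, all defined pointwise in `S`: `lookup` is the diagonal
`f ↦ λ s. f s s`, `update` is `m ↦ λ s. λ t. m s`, and `step` is that of `A` at each `s : S`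
(`powerAlg`). The equations are those of the reader monad together with naturality, and every map
`φ` commuting with the `▷`-structures induces a homomorphism `φ ^ S` (`powerAlgMap`). With
`A = D (S × X)` this makes `M X` a GSD-algebra, and the functorial action and the multiplication
of the monad `M` become homomorphisms.

For a GSD-algebra `A` and `f : X → A`, the type `D (S × X)` is initial among the types with maps
from `S × X` and from `▷` of themselves, so that there is a unique `A.eval f : D (S × X) → A` with
`now (s, x) ↦ update (f x) s` that commutes with `step` (`delayFold`, `delay_hom_ext`). It runs
a computation in `A` without reading the state, and writes the state when it ends; so an `update`
before it has no effect: `update (A.eval f d) s = A.eval f d` (`GSDAlg.eval_update`). The extension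
of `f` is `m ↦ lookup (λ s. A.eval f (m s))` (`freeLift`). It is the only homomorphism extending
`f`, since in `M X` every `m` equals `lookup (λ s. λ t. m s)`, and a homomorphism precomposed with
`d ↦ λ t. d` satisfies the equations that define `A.eval f` (`GSDAlg.eq_map_eval_lookup`).

Hence `M X` is the free algebra on `X`. The unit of the adjunction is that of `M` by construction,
and its counit at `M X` is the multiplication of `M`, because both are homomorphisms that restrict
to the identity along the unit (`freeLift_id`).
-/

namespace GuardedState

variable {Γ : Ctx.{u}}

/-! ### Powers by a type -/

section Power

variable {S : Ty Γ}

lemma exp_hom_ext {A B : Ty Γ} {φ ψ : A ⟶ (ihom S).obj B}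
    (h : ∀ (c : Γ.Elements) (x : A.obj c) (d : Γ.Elements) (f : c ⟶ d) (s : S.obj d),
      expApp (φ.app c x) f s = expApp (ψ.app c x) f s) : φ = ψ := by
  ext c x
  exact exp_ext (h c x)

lemma expApp_expDiag {A : Ty Γ} {c d : Γ.Elements}
    (x : ((ihom S).obj ((ihom S).obj A)).obj c) (f : c ⟶ d) (s : S.obj d) :
    expApp ((expDiag S A).app c x) f s = expApp (expApp x f s) (𝟙 d) s := rfl

lemma expApp_laterExp (κ : Clock Γ) {A : Ty Γ} {c d : Γ.Elements}
    (x : ((later κ).obj ((ihom S).obj A)).obj c) (f : c ⟶ d) (s : S.obj d) (h : 0 < κ.left d) :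
    (expApp ((laterExp κ S A).app c x) f s : 0 < κ.left d → A.obj (κ.tick d)) h =
      expApp (x (h.trans_le (κ.left_le f))) (κ.tickMap f) (S.map (κ.toTick d) s) := rfl

lemma expDiag_naturality {A B : Ty Γ} (φ : A ⟶ B) :
    expDiag S A ≫ (ihom S).map φ = (ihom S).map ((ihom S).map φ) ≫ expDiag S B := rfl

lemma expConst_naturality {A B : Ty Γ} (φ : A ⟶ B) :
    expConst S A ≫ (ihom S).map φ = φ ≫ expConst S B :=
  exp_hom_ext fun _ x _ f _ => NatTrans.naturality_apply φ f x

lemma map_expConst_naturality {A B : Ty Γ} (φ : A ⟶ B) :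
    (ihom S).map (expConst S A) ≫ (ihom S).map ((ihom S).map φ) =
      (ihom S).map φ ≫ (ihom S).map (expConst S B) := by
  rw [← Functor.map_comp, ← Functor.map_comp, expConst_naturality]

lemma laterStrength_naturality (κ : Clock Γ) {A B : Ty Γ} (φ : A ⟶ B) :
    laterStrength κ S A ≫ (later κ).map (S ◁ φ) = (S ◁ (later κ).map φ) ≫ laterStrength κ S B :=
  rfl

lemma laterExp_naturality (κ : Clock Γ) {A B : Ty Γ} (φ : A ⟶ B) :
    laterExp κ S A ≫ (ihom S).map ((later κ).map φ) =
      (later κ).map ((ihom S).map φ) ≫ laterExp κ S B := by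
  rw [laterExp, laterExp, ← MonoidalClosed.curry_natural_right, Category.assoc,
    ← Functor.map_comp, ← ihom.ev_naturality, Functor.map_comp, ← Category.assoc,
    laterStrength_naturality, Category.assoc, MonoidalClosed.curry_natural_left]

lemma expConst_expDiag (A : Ty Γ) : expConst S ((ihom S).obj A) ≫ expDiag S A = 𝟙 _ :=
  exp_hom_ext fun _ x _ f s => congrArg (fun g => expApp x g s) (Category.comp_id f)

lemma map_expConst_expDiag (A : Ty Γ) : (ihom S).map (expConst S A) ≫ expDiag S A = 𝟙 _ :=
  exp_hom_ext fun c x d f s => by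
    change A.map (𝟙 d) (expApp x f s) = expApp x f s
    simp

lemma map_expDiag_expDiag (A : Ty Γ) :
    (ihom S).map (expDiag S A) ≫ expDiag S A = expDiag S ((ihom S).obj A) ≫ expDiag S A :=
  -- both sides unfold to `λ s. x s s s`; a single `rfl` is very slow to check
  exp_hom_ext fun c x d f s => by
    calc expApp ((expDiag S A).app c (((ihom S).map (expDiag S A)).app c x)) f s
        = expApp (expApp (((ihom S).map (expDiag S A)).app c x) f s) (𝟙 d) s :=
          expApp_expDiag _ f s
      _ = expApp (expApp (expApp x f s) (𝟙 d) s) (𝟙 d) s := expApp_expDiag (expApp x f s) (𝟙 d) s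
      _ = expApp (expApp ((expDiag S ((ihom S).obj A)).app c x) f s) (𝟙 d) s :=
          congrArg (fun y => expApp y (𝟙 d) s) (expApp_expDiag x f s).symm
      _ = expApp ((expDiag S A).app c ((expDiag S ((ihom S).obj A)).app c x)) f s :=
          (expApp_expDiag ((expDiag S ((ihom S).obj A)).app c x) f s).symm

/-- The map `▷ (A ^ S) → A ^ S`, `d ↦ λ s. σ (λ α. d [α] s)`, for `σ : ▷ A → A`. -/
noncomputable def expStep (κ : Clock Γ) (S : Ty Γ) {A : Ty Γ} (σ : (later κ).obj A ⟶ A) :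
    (later κ).obj ((ihom S).obj A) ⟶ (ihom S).obj A :=
  laterExp κ S A ≫ (ihom S).map σ

lemma expStep_naturality (κ : Clock Γ) {A B : Ty Γ} {σ : (later κ).obj A ⟶ A}
    {τ : (later κ).obj B ⟶ B} {φ : A ⟶ B} (h : σ ≫ φ = (later κ).map φ ≫ τ) :
    expStep κ S σ ≫ (ihom S).map φ = (later κ).map ((ihom S).map φ) ≫ expStep κ S τ := by
  rw [expStep, expStep, Category.assoc, ← Functor.map_comp, h, Functor.map_comp,
    ← Category.assoc, laterExp_naturality, Category.assoc]

lemma step_expConst (κ : Clock Γ) {A : Ty Γ} (σ : (later κ).obj A ⟶ A) :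
    σ ≫ expConst S A = (later κ).map (expConst S A) ≫ expStep κ S σ :=
  exp_hom_ext fun _ x _ f _ => (NatTrans.naturality_apply σ f x).symm

lemma map_expDiag_expStep (κ : Clock Γ) {A : Ty Γ} (σ : (later κ).obj A ⟶ A) :
    (later κ).map (expDiag S A) ≫ expStep κ S σ =
      laterExp κ S ((ihom S).obj A) ≫ (ihom S).map (expStep κ S σ) ≫ expDiag S A :=
  exp_hom_ext fun _ x d f s => congrArg (σ.app d) (funext fun h => by
    refine (expApp_laterExp κ (((later κ).map (expDiag S A)).app _ x) f s h).trans ?_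
    exact (expApp_laterExp κ ((expApp ((laterExp κ S _).app _ x) f s)) (𝟙 d) s h).symm)

end Power

/-! ### The GSD-algebra on a power -/

/-- The GSD-algebra on `A ^ S`, for a type `A` with a map `σ : ▷ A → A`, with operations
`lookup f = λ s. f s s`, `update m = λ s. λ t. m s` and `step d = λ s. σ (λ α. d [α] s)`. -/
noncomputable def powerAlg {κ : Clock Γ} (S : SetTy Γ) (A : Ty Γ) (hA : ClockIrrelevant A)
    (σ : (later κ).obj A ⟶ A) : GSDAlg κ S where
  carrier := ⟨(ihom S.obj).obj A, hA.exp S.obj⟩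
  lookup := expDiag S.obj A
  update := (ihom S.obj).map (expConst S.obj A)
  step := expStep κ S.obj σ
  lookup_lookup := map_expDiag_expDiag A
  lookup_update := map_expConst_expDiag A
  update_lookup := expDiag_naturality _
  update_update := by
    rw [← Functor.map_comp, ← Functor.map_comp, expConst_naturality]
  step_lookup := map_expDiag_expStep κ σ
  update_step := expStep_naturality κ (step_expConst κ σ)

/-- The homomorphism `A ^ S → B ^ S` given by composition with a map `φ : A → B` that commutes with
the maps `▷ A → A` and `▷ B → B`. -/
noncomputable def powerAlgMap {κ : Clock Γ} (S : SetTy Γ) {A B : Ty Γ} {hA : ClockIrrelevant A}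
    {hB : ClockIrrelevant B} {σ : (later κ).obj A ⟶ A} {τ : (later κ).obj B ⟶ B} (φ : A ⟶ B)
    (h : σ ≫ φ = (later κ).map φ ≫ τ) : powerAlg S A hA σ ⟶ powerAlg S B hB τ :=
  GSDAlg.Hom.mk (A := powerAlg S A hA σ) (B := powerAlg S B hB τ)
    (ObjectProperty.homMk ((ihom S.obj).map φ))
    (expDiag_naturality φ)
    (map_expConst_naturality φ)
    (expStep_naturality κ h)

/-! ### Recursion on guarded delays -/

variable {κ : Clock Γ}

/-- The recursion on `D A` with `now x ↦ φ x` and `step d ↦ σ (λ α. r (d [α]))`, where `r` is the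
recursive call. -/
def Delay.fold {A B : Ty Γ} (φ : A ⟶ B) (σ : (later κ).obj B ⟶ B) :
    ∀ {c : Γ.Elements}, Delay κ A c → B.obj c
  | _, .now x => φ.app _ x
  | c, .step d => σ.app c fun h => Delay.fold φ σ (d h)

lemma Delay.fold_restrict {A B : Ty Γ} (φ : A ⟶ B) (σ : (later κ).obj B ⟶ B) {c d : Γ.Elements}
    (f : c ⟶ d) (x : Delay κ A c) : (x.restrict f).fold φ σ = B.map f (x.fold φ σ) := by
  induction x generalizing d with
  | now x => exact NatTrans.naturality_apply φ f x
  | step e ih =>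
    refine Eq.trans ?_ (NatTrans.naturality_apply σ f _)
    exact congrArg (σ.app d) (funext fun h => ih _ (κ.tickMap f))

/-- `Delay.fold` as a map of types `D A → B`. -/
def delayFold {A B : Ty Γ} (φ : A ⟶ B) (σ : (later κ).obj B ⟶ B) : delayTy κ A ⟶ B where
  app c := ↾Delay.fold φ σ
  naturality c d f := by ext x; exact x.fold_restrict φ σ f

lemma now_delayFold {A B : Ty Γ} (φ : A ⟶ B) (σ : (later κ).obj B ⟶ B) :
    now κ A ≫ delayFold φ σ = φ := rfl

lemma step_delayFold {A B : Ty Γ} (φ : A ⟶ B) (σ : (later κ).obj B ⟶ B) :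
    step κ A ≫ delayFold φ σ = (later κ).map (delayFold φ σ) ≫ σ := rfl

/-- Uniqueness in the initiality of `D A`. -/
lemma delay_hom_ext {A B : Ty Γ} (σ : (later κ).obj B ⟶ B) {φ ψ : delayTy κ A ⟶ B}
    (hn : now κ A ≫ φ = now κ A ≫ ψ) (hφ : step κ A ≫ φ = (later κ).map φ ≫ σ)
    (hψ : step κ A ≫ ψ = (later κ).map ψ ≫ σ) : φ = ψ := by
  ext c x
  change Delay κ A c at x
  induction x with
  | now x => exact ConcreteCategory.congr_hom (NatTrans.congr_app hn _) x
  | @step c d ih =>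
    refine (ConcreteCategory.congr_hom (NatTrans.congr_app hφ c) d).trans
      (Eq.trans ?_ (ConcreteCategory.congr_hom (NatTrans.congr_app hψ c) d).symm)
    exact congrArg (σ.app c) (funext fun h => ih h)

lemma step_delayExt {A B : Ty Γ} (φ : A ⟶ delayTy κ B) :
    step κ A ≫ delayExt φ = (later κ).map (delayExt φ) ≫ step κ B := rfl

/-! ### Running computations in a GSD-algebra -/

namespace GSDAlg

variable {S : SetTy Γ}

/-- `lookup (λ s. x) = x`: write `x = lookup (update x)` and merge the two lookups. -/
lemma expConst_lookup (A : GSDAlg κ S) : expConst S.obj A.carrier.obj ≫ A.lookup = 𝟙 _ := by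
  calc expConst S.obj A.carrier.obj ≫ A.lookup
      = A.update ≫ (A.lookup ≫ expConst S.obj A.carrier.obj) ≫ A.lookup := by
        rw [Category.assoc, ← Category.assoc, A.lookup_update, Category.id_comp]
    _ = A.update ≫ expConst S.obj _ ≫ (ihom S.obj).map A.lookup ≫ A.lookup := by
        rw [← expConst_naturality, Category.assoc]
    _ = 𝟙 _ := by
        rw [A.lookup_lookup, ← Category.assoc (expConst S.obj _), expConst_expDiag,
          Category.id_comp, A.lookup_update]

/-- The map `D (S × X) → A` that runs a computation in the algebra `A`, with
`now (s, x) ↦ update (f x) s` and `step` interpreted by that of `A`. -/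
noncomputable def eval (A : GSDAlg κ S) {X : Ty Γ} (f : X ⟶ A.carrier.obj) :
    delayTy κ (S.obj ⊗ X) ⟶ A.carrier.obj :=
  delayFold (MonoidalClosed.uncurry (f ≫ A.update)) A.step

lemma now_eval (A : GSDAlg κ S) {X : Ty Γ} (f : X ⟶ A.carrier.obj) :
    now κ (S.obj ⊗ X) ≫ A.eval f = MonoidalClosed.uncurry (f ≫ A.update) :=
  now_delayFold _ _

lemma step_eval (A : GSDAlg κ S) {X : Ty Γ} (f : X ⟶ A.carrier.obj) :
    GuardedState.step κ (S.obj ⊗ X) ≫ A.eval f = (later κ).map (A.eval f) ≫ A.step :=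
  step_delayFold _ _

/-- Running a computation overwrites the state, so an earlier `update` has no effect. Both sides are
maps `D (S × X) → A ^ S` that commute with `step`, and they agree on `now`. -/
lemma eval_update (A : GSDAlg κ S) {X : Ty Γ} (f : X ⟶ A.carrier.obj) :
    A.eval f ≫ A.update = A.eval f ≫ expConst S.obj A.carrier.obj := by
  refine delay_hom_ext (expStep κ S.obj A.step) ?_ ?_ ?_
  · rw [← Category.assoc, now_eval, ← Category.assoc, now_eval,
      ← MonoidalClosed.uncurry_natural_right, ← MonoidalClosed.uncurry_natural_right,
      Category.assoc, Category.assoc, A.update_update]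
  · rw [← Category.assoc, step_eval, Category.assoc, A.update_step, Functor.map_comp,
      Category.assoc, expStep]
  · rw [← Category.assoc, step_eval, Category.assoc, step_expConst, Functor.map_comp,
      Category.assoc]

/-- A homomorphism `h : (D (S × X)) ^ S → A` is determined by its restriction to `X` along the unit
`x ↦ λ s. now (s, x)`. -/
lemma eq_map_eval_lookup (A : GSDAlg κ S) {X : Ty Γ}
    (h : (ihom S.obj).obj (delayTy κ (S.obj ⊗ X)) ⟶ A.carrier.obj)
    (h_lookup : expDiag S.obj _ ≫ h = (ihom S.obj).map h ≫ A.lookup)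
    (h_update : (ihom S.obj).map (expConst S.obj _) ≫ (ihom S.obj).map h = h ≫ A.update)
    (h_step : expStep κ S.obj (GuardedState.step κ (S.obj ⊗ X)) ≫ h = (later κ).map h ≫ A.step) :
    h = (ihom S.obj).map (A.eval (MonoidalClosed.curry (now κ (S.obj ⊗ X)) ≫ h)) ≫ A.lookup := by
  -- `d ↦ h (λ t. d)` satisfies the equations that determine `A.eval`
  have key : A.eval (MonoidalClosed.curry (now κ (S.obj ⊗ X)) ≫ h) =
      expConst S.obj (delayTy κ (S.obj ⊗ X)) ≫ h := by
    refine delay_hom_ext A.step ?_ (A.step_eval _) ?_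
    · rw [now_eval, Category.assoc, ← h_update, ← Functor.map_comp,
        MonoidalClosed.uncurry_natural_right, MonoidalClosed.uncurry_curry]
    · rw [← Category.assoc, step_expConst, Category.assoc, h_step, Functor.map_comp,
        Category.assoc]
  -- `m = lookup (λ s. λ t. m s)`
  rw [key, Functor.map_comp, Category.assoc, ← h_lookup, ← Category.assoc,
    map_expConst_expDiag, Category.id_comp]

end GSDAlg

/-! ### The free algebra and its adjunction -/

/-- The free GSD-algebra on `X`: the algebra `(D (S × X)) ^ S`. -/
noncomputable def free (κ : Clock Γ) (S X : SetTy Γ) : GSDAlg κ S :=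
  powerAlg S (delayTy κ (S.obj ⊗ X.obj)) ((S.property.prod X.property).delay κ)
    (step κ (S.obj ⊗ X.obj))

/-- The extension `m ↦ lookup (λ s. A.eval f (m s))` of `f` to a homomorphism. -/
noncomputable def freeLift {S X : SetTy Γ} (A : GSDAlg κ S) (f : X ⟶ A.carrier) :
    free κ S X ⟶ A :=
  GSDAlg.Hom.mk (A := free κ S X) (B := A)
    (ObjectProperty.homMk ((ihom S.obj).map (A.eval f.hom) ≫ A.lookup))
    (by
      change expDiag S.obj (delayTy κ (S.obj ⊗ X.obj)) ≫
        (ihom S.obj).map (A.eval f.hom) ≫ A.lookup =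
        (ihom S.obj).map ((ihom S.obj).map (A.eval f.hom) ≫ A.lookup) ≫ A.lookup
      rw [Functor.map_comp, Category.assoc, A.lookup_lookup, ← Category.assoc,
        expDiag_naturality, Category.assoc])
    (by
      change (ihom S.obj).map (expConst S.obj (delayTy κ (S.obj ⊗ X.obj))) ≫
        (ihom S.obj).map ((ihom S.obj).map (A.eval f.hom) ≫ A.lookup) =
        ((ihom S.obj).map (A.eval f.hom) ≫ A.lookup) ≫ A.update
      rw [← Functor.map_comp, ← Category.assoc, expConst_naturality, Category.assoc,
        A.expConst_lookup, Category.comp_id, Category.assoc, A.update_lookup, ← Category.assoc,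
        ← Functor.map_comp, A.eval_update, Functor.map_comp, Category.assoc,
        map_expConst_expDiag, Category.comp_id])
    (by
      change expStep κ S.obj (step κ (S.obj ⊗ X.obj)) ≫
        (ihom S.obj).map (A.eval f.hom) ≫ A.lookup =
        (later κ).map ((ihom S.obj).map (A.eval f.hom) ≫ A.lookup) ≫ A.step
      rw [← Category.assoc, expStep_naturality κ (A.step_eval f.hom), Category.assoc,
        Functor.map_comp, Category.assoc, A.step_lookup, expStep, Category.assoc])

/-- `freeLift A f` extends `f`, because `lookup (λ s. update (f x) s) = f x`. -/
lemma unit_freeLift {S X : SetTy Γ} (A : GSDAlg κ S) (f : X ⟶ A.carrier) :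
    (stateDelayMonad κ S).η.app X ≫ (freeLift A f).map = f := by
  apply ObjectProperty.hom_ext
  change MonoidalClosed.curry (now κ (S.obj ⊗ X.obj)) ≫
    (ihom S.obj).map (A.eval f.hom) ≫ A.lookup = f.hom
  rw [← Category.assoc, ← MonoidalClosed.curry_natural_right, A.now_eval,
    MonoidalClosed.curry_uncurry, Category.assoc, A.lookup_update, Category.comp_id]

lemma eq_freeLift {S X : SetTy Γ} (A : GSDAlg κ S) (h : free κ S X ⟶ A) :
    h = freeLift A ((stateDelayMonad κ S).η.app X ≫ h.map) :=
  GSDAlg.Hom.ext (ObjectProperty.hom_ext _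
    (A.eq_map_eval_lookup h.map.hom h.map_lookup h.map_update h.map_step))

/-- The universal property of the free algebra: restriction along the unit. -/
noncomputable def freeEquiv {S : SetTy Γ} (X : SetTy Γ) (A : GSDAlg κ S) :
    (free κ S X ⟶ A) ≃ (X ⟶ (GSDAlg.forget κ S).obj A) where
  toFun h := (stateDelayMonad κ S).η.app X ≫ h.map
  invFun f := freeLift A f
  left_inv h := (eq_freeLift A h).symm
  right_inv f := unit_freeLift A f

/-- The functorial action of the monad `(D (S × -)) ^ S`, as a homomorphism. -/
noncomputable def freeMap (κ : Clock Γ) (S : SetTy Γ) {X Y : SetTy Γ} (φ : X ⟶ Y) :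
    free κ S X ⟶ free κ S Y :=
  powerAlgMap S (delayExt ((S.obj ◁ φ.hom) ≫ now κ _)) (step_delayExt _)

lemma freeMap_freeLift {S X Y : SetTy Γ} (A : GSDAlg κ S) (φ : X ⟶ Y) (f : Y ⟶ A.carrier) :
    freeMap κ S φ ≫ freeLift A f = freeLift A (φ ≫ f) := by
  have h : (stateDelayMonad κ S).η.app X ≫ (freeMap κ S φ).map =
      φ ≫ (stateDelayMonad κ S).η.app Y :=
    ((stateDelayMonad κ S).η.naturality φ).symm
  refine (eq_freeLift A _).trans (congrArg (freeLift A) ?_)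
  calc (stateDelayMonad κ S).η.app X ≫ (freeMap κ S φ).map ≫ (freeLift A f).map
      = ((stateDelayMonad κ S).η.app X ≫ (freeMap κ S φ).map) ≫ (freeLift A f).map :=
        (Category.assoc _ _ _).symm
    _ = (φ ≫ (stateDelayMonad κ S).η.app Y) ≫ (freeLift A f).map :=
        congrArg (· ≫ (freeLift A f).map) h
    _ = φ ≫ (stateDelayMonad κ S).η.app Y ≫ (freeLift A f).map := Category.assoc _ _ _
    _ = φ ≫ f := congrArg (φ ≫ ·) (unit_freeLift A f)

/-- The multiplication of the monad `(D (S × -)) ^ S`, as a homomorphism. -/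
noncomputable def freeMul (κ : Clock Γ) (S X : SetTy Γ) :
    free κ S ((stateDelayMonad κ S).obj X) ⟶ free κ S X :=
  powerAlgMap S (delayExt ((ihom.ev S.obj).app (delayTy κ (S.obj ⊗ X.obj)))) (step_delayExt _)

/-- The free algebra functor. Its composite with the forgetful functor is definitionally the functor
underlying the monad `(D (S × -)) ^ S`. -/
noncomputable def freeFunctor (κ : Clock Γ) (S : SetTy Γ) : SetTy Γ ⥤ GSDAlg κ S where
  obj := free κ S
  map := freeMap κ S
  map_id X := GSDAlg.Hom.ext ((stateDelayMonad κ S).map_id X)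
  map_comp φ ψ := GSDAlg.Hom.ext ((stateDelayMonad κ S).map_comp φ ψ)

/-- The free algebra functor is left adjoint to the forgetful functor. -/
noncomputable def freeAdj (κ : Clock Γ) (S : SetTy Γ) : freeFunctor κ S ⊣ GSDAlg.forget κ S :=
  Adjunction.mkOfHomEquiv
    { homEquiv := freeEquiv
      homEquiv_naturality_left_symm := fun {_ _ A} φ f => (freeMap_freeLift A φ f).symm
      homEquiv_naturality_right := fun {X _ _} f g =>
        (Category.assoc ((stateDelayMonad κ S).η.app X) f.map g.map).symm }

/-- The counit of the adjunction at a free algebra is the multiplication of the monad. -/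
lemma freeLift_id (S X : SetTy Γ) :
    freeLift (free κ S X) (𝟙 _) = freeMul κ S X := by
  apply (freeEquiv _ _).injective
  exact (unit_freeLift (free κ S X) (𝟙 _)).trans ((stateDelayMonad κ S).left_unit X).symm

end GuardedState

open GuardedState

theorem theorem4p2 (Γ : GuardedState.Ctx.{u}) (κ : GuardedState.Clock Γ)
    (S : GuardedState.SetTy Γ) :
    ∃ (F : GuardedState.SetTy Γ ⥤ GuardedState.GSDAlg κ S)
      (adj : F ⊣ GuardedState.GSDAlg.forget κ S),
      Nonempty (adj.toMonad ≅ GuardedState.stateDelayMonad κ S) := by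
  have hη (X : SetTy Γ) :
      (freeAdj κ S).unit.app X = (stateDelayMonad κ S).η.app X :=
    Category.comp_id ((stateDelayMonad κ S).η.app X)
  have hμ (X : SetTy Γ) :
      ((freeAdj κ S).counit.app (free κ S X)).map = (stateDelayMonad κ S).μ.app X :=
    congrArg GSDAlg.Hom.map (freeLift_id S X)
  -- the underlying functors agree definitionally, so all components of the isomorphism are identities
  refine ⟨freeFunctor κ S, freeAdj κ S, ⟨MonadIso.mk
    (NatIso.ofComponents (fun X => Iso.refl _) ?_) ?_ ?_⟩⟩
  · intro X Y φ
    exact (Category.comp_id _).trans (Category.id_comp _).symm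
  · intro X
    exact (Category.comp_id _).trans (hη X)
  · intro X
    let M := stateDelayMonad κ S
    have h : (M.map (𝟙 (M.obj X)) ≫ 𝟙 (M.obj (M.obj X))) ≫ M.μ.app X = M.μ.app X := by
      rw [M.map_id, Category.comp_id, Category.id_comp]
    exact (Category.comp_id _).trans ((hμ X).trans h.symm)
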